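/- Let $Y$ be a positive random variable whose moment generating function is finite in a neighbourhood of $0$, and let $\lambda>0$, $\theta>0$, $c=(1+\theta)\lambda\,\mathbb E[Y]$. For real $n>0$ consider the scaled Cramér–Lundberg model with initial surplus $x\ge 0$, $$X^{(n)}_t = x + c_n t-\sum_{i=1}^{N^{(n)}_t} Y^{(n)}_i,\qquad t\ge 0,$$ where $c_n=c+(\sqrt n-1)\lambda\,\mathbb E[Y]$, $N^{(n)}$ is a homogeneous Poisson process with intensity $n\lambda$, and the claims $Y^{(n)}_1,Y^{(n)}_2,\dots$ are independent, distributed as $Y/\sqrt n$, and independent of $N^{(n)}$. Let $\tau^{(n)}_x=\inf\{t\ge 0: X^{(n)}_t<0\}$ be the time of ruin (with $\inf\emptyset=\infty$), let $\psi_n(x)=\mathbb P(\tau^{(n)}_x<\infty)$ be the probability of ultimate ruin, and put $\gamma = 2\theta\,\mathbb E[Y]/\mathbb E[Y^2]$. Assume that there is $m>0$ such that $$\sup_{d}\ \mathbb E\Big((Y-d)^2\, e^{\frac{\gamma}{\sqrt m}(Y-d)}\,\Big|\, Y>d\Big)<\infty,$$ where the supremum is over all $d\ge 0$ with $\mathbb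 P(Y>d)>0$. Then there exist $C>0$ and $N>0$ such that, for all real $n>N$ and all $x\ge 0$, $$\big|\psi_n(x)-e^{-\gamma x}\big|\le \frac{C}{\sqrt n}.$$ -/

import Mathlib

open MeasureTheory ProbabilityTheory
open scoped NNReal ENNReal

noncomputable section

/-- `N` is a homogeneous Poisson process with intensity `r`: it counts arrivals whose
inter-arrival times `T 0, T 1, …` are i.i.d. exponential with rate `r`. The `k`-th arrival
happens at time `T 0 + ⋯ + T (k - 1)`, and `k ≤ N t` says that it has happened by time `t`. -/
structure IsHomogeneousPoissonProcess {Ω : Type*} [MeasurableSpace Ω] (N : ℝ≥0 → Ω → ℕ)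
    (r : ℝ) (P : Measure Ω) : Prop where
  measurable : ∀ t, Measurable (N t)
  exists_interarrival : ∃ T : ℕ → Ω → ℝ,
    (∀ i, HasLaw (T i) (expMeasure r) P) ∧ iIndepFun T P ∧
    ∀ᵐ ω ∂P, ∀ (t : ℝ≥0) (k : ℕ), k ≤ N t ω ↔ ∑ i ∈ Finset.range k, T i ω ≤ (t : ℝ)

/-- The random ingredients of the Cramér–Lundberg model: a homogeneous Poisson claim-number
process `N` of intensity `r`, and i.i.d. claim sizes `Y 0, Y 1, …` with law `ν`, the whole claim
sequence being independent of the process `N`. -/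
structure IsCramerLundberg {Ω : Type*} [MeasurableSpace Ω] (N : ℝ≥0 → Ω → ℕ) (Y : ℕ → Ω → ℝ)
    (r : ℝ) (ν : Measure ℝ) (P : Measure Ω) : Prop where
  poisson : IsHomogeneousPoissonProcess N r P
  measurable_claim : ∀ i, Measurable (Y i)
  law_claim : ∀ i, HasLaw (Y i) ν P
  iIndepFun_claim : iIndepFun Y P
  indepFun_claim_poisson : IndepFun (fun ω i => Y i ω) (fun ω t => N t ω) P

/-- The surplus `X_t = x + c t - ∑_{i ≤ N_t} Y_i`. -/
def surplus {Ω : Type*} (x c : ℝ) (N : ℝ≥0 → Ω → ℕ) (Y : ℕ → Ω → ℝ) (t : ℝ≥0) (ω : Ω) : ℝ :=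
  x + c * (t : ℝ) - ∑ i ∈ Finset.range (N t ω), Y i ω

/-- The time of ruin `inf {t ≥ 0 : X_t < 0}`, equal to `∞` if ruin never occurs. -/
def ruinTime {Ω : Type*} (X : ℝ≥0 → Ω → ℝ) (ω : Ω) : ℝ≥0∞ :=
  ⨅ (t : ℝ≥0) (_ : X t ω < 0), (t : ℝ≥0∞)

/-- The probability of ultimate ruin, with initial surplus `x` and premium rate `c`. -/
def ruinProb {Ω : Type*} [MeasurableSpace Ω] (P : Measure Ω) (N : ℝ≥0 → Ω → ℕ)
    (Y : ℕ → Ω → ℝ) (c x : ℝ) : ℝ :=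
  P.real {ω | ruinTime (surplus x c N Y) ω < ∞}

/-- The premium rate `c = (1 + θ) lam E[Y]` with risk loading `θ`. -/
def premium (lam θ : ℝ) (ν : Measure ℝ) : ℝ := (1 + θ) * lam * ∫ y, y ∂ν

/-- The premium rate `c_n = c + (√n - 1) lam E[Y]` of the scaled model. -/
def scaledPremium (lam θ : ℝ) (ν : Measure ℝ) (n : ℝ) : ℝ :=
  premium lam θ ν + (Real.sqrt n - 1) * lam * ∫ y, y ∂ν

/-- The law of the scaled claim `Y / √n`. -/
def scaledClaimLaw (ν : Measure ℝ) (n : ℝ) : Measure ℝ := ν.map (fun y => y / Real.sqrt n)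

/-- `γ = 2 θ E[Y] / E[Y²]`. -/
def ruinExponent (θ : ℝ) (ν : Measure ℝ) : ℝ := 2 * θ * (∫ y, y ∂ν) / ∫ y, y ^ 2 ∂ν

/-- For some `m > 0`, `sup_{d ≥ 0} E((Y - d)² exp((γ / √m) (Y - d)) | Y > d) < ∞`. The conditional
measure is zero where `P(Y > d) = 0`, so such `d` do not contribute to the supremum. -/
def UniformCondMoment (θ : ℝ) (ν : Measure ℝ) : Prop :=
  ∃ m : ℝ, 0 < m ∧
    (⨆ (d : ℝ) (_ : 0 ≤ d), (∫⁻ y, ENNReal.ofReal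
      ((y - d) ^ 2 * Real.exp (ruinExponent θ ν / Real.sqrt m * (y - d)))
        ∂(ProbabilityTheory.cond ν (Set.Ioi d)))) < ∞

end

/-!
Ruin happens exactly when the random walk with steps `Z i - c T i` (claim minus premium income
between claims) exceeds the initial surplus `x`, so `ψ` is the limit of the probabilities `p k x`
that the walk exceeds `x` within `k` steps. Conditioning on the first claim and the first waiting
time gives the renewal equation `pathLaw_crossingEvent_succ`, and induction on `k` compares `p k`
with exponentials. No Lundberg exponent has to be constructed:

* If the step has moment generating function at most `1` at `s`, then `p k x ≤ e^{-s x}`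
  (`pathLaw_crossingEvent_le`).
* If the step has moment generating function at least `1` at `g`, and the overshoot over any level
  has conditional exponential moment at most `K`, then the function equal to `1` for `x < 0` and to
  `e^{-g x} / K` for `x ≥ 0` is a subsolution of the renewal equation. It is therefore at most
  `p k x` up to an error which decays geometrically in `k`, with the moment generating function at
  some `s ≤ g` as ratio, provided that this is less than `1`
  (`overshootBarrier_le_pathLaw_crossingEvent`).

In the scaled model the condition on the exponent `√n u` compares `E e^{u Y}` with
`1 + u E[Y] (1 + θ / √n)` (`stepMGF_scaled`). The bound `E e^{u Y} ≥ 1 + u E[Y] + u² E[Y²] / 2`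
shows that `g = γ` is admissible, and the matching upper bound with a cubic error shows that
`s = γ - A / √n` is admissible for a suitable constant `A`. The hypothesis on the conditional
moments gives `K = 1 + O(1 / √n)` (`UniformCondMoment.exists_overshoot_bound`). As
`e^{-s x} - e^{-γ x} ≤ (γ - s) / s` for all `x ≥ 0`, both bounds are within `O(1 / √n)` of
`e^{-γ x}`, uniformly in `x`.

The waiting times `T i` of the Poisson process are only known to exist. They are almost surely
measurable functions of the path of the process (`ae_eq_arrivalTime_sub`), which makes them
independent of the claims.
-/

/-! ### Sequences of independent random variables: splitting off the first term -/

/-- The sequence with first term `p.1` followed by the sequence `p.2`. -/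
def consSeq {α : Type*} (p : α × (ℕ → α)) : ℕ → α
  | 0 => p.1
  | i + 1 => p.2 i

lemma measurable_consSeq {α : Type*} [MeasurableSpace α] : Measurable (consSeq (α := α)) := by
  refine measurable_pi_iff.2 fun i => ?_
  cases i with
  | zero => exact measurable_fst
  | succ i => exact (measurable_pi_apply i).comp measurable_snd

lemma map_consSeq_prod_infinitePi {α : Type*} [MeasurableSpace α] (μ : Measure α)
    [IsProbabilityMeasure μ] :
    (μ.prod (Measure.infinitePi fun _ : ℕ => μ)).map consSeq =
      Measure.infinitePi fun _ : ℕ => μ := by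
  classical
  refine Measure.eq_infinitePi _ fun s t ht => ?_
  set t' : ℕ → Set α := fun i => if i ∈ s then t i else Set.univ with ht'
  have hmt' : ∀ i, MeasurableSet (t' i) := fun i => by
    simp only [ht']; split_ifs
    exacts [ht i, MeasurableSet.univ]
  -- Both sides are compared on cylinders over the initial segment of length `s.sup id + 1`, which
  -- always contains the coordinate `0` and is mapped to an initial segment by the shift.
  have hpre : consSeq ⁻¹' (Set.pi (s : Set ℕ) t) =
      t' 0 ×ˢ Set.pi ((Finset.range (s.sup id)) : Set ℕ) fun i => t' (i + 1) := by
    ext p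
    simp only [Set.mem_preimage, Set.mem_pi, Set.mem_prod, Finset.mem_coe, Finset.mem_range, ht']
    constructor
    · intro h
      refine ⟨?_, fun i _ => ?_⟩
      · split_ifs with h0
        exacts [h 0 h0, Set.mem_univ _]
      · split_ifs with hi
        exacts [h (i + 1) hi, Set.mem_univ _]
    · rintro ⟨h0, h1⟩ i hi
      cases i with
      | zero => simpa [hi, consSeq] using h0
      | succ i =>
        have := h1 i (Nat.lt_of_succ_le (Finset.le_sup (f := id) hi))
        simpa [hi, consSeq] using this
  have hprod : ∏ i ∈ s, μ (t i) = ∏ i ∈ Finset.range (s.sup id + 1), μ (t' i) := by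
    have hsub : s ⊆ Finset.range (s.sup id + 1) := fun i hi =>
      Finset.mem_range.2 (Nat.lt_succ_of_le (Finset.le_sup (f := id) hi))
    rw [← Finset.prod_subset hsub]
    · exact Finset.prod_congr rfl fun i hi => by simp [ht', hi]
    · intro i _ hi
      simp [ht', hi]
  rw [Measure.map_apply measurable_consSeq
    (MeasurableSet.pi s.countable_toSet fun i _ => ht i), hpre, Measure.prod_prod,
    Measure.infinitePi_pi _ (fun i _ => hmt' (i + 1)), hprod, Finset.prod_range_succ', mul_comm]

lemma lintegral_infinitePi_eq_lintegral_consSeq {α : Type*} [MeasurableSpace α] (μ : Measure α)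
    [IsProbabilityMeasure μ] {f : (ℕ → α) → ℝ≥0∞} (hf : Measurable f) :
    ∫⁻ s, f s ∂(Measure.infinitePi fun _ : ℕ => μ) =
      ∫⁻ a, ∫⁻ s, f (consSeq (a, s)) ∂(Measure.infinitePi fun _ : ℕ => μ) ∂μ := by
  conv_lhs => rw [← map_consSeq_prod_infinitePi μ]
  rw [lintegral_map hf measurable_consSeq,
    lintegral_prod (fun p => f (consSeq p)) (hf.comp measurable_consSeq).aemeasurable]

/-! ### The running maximum of a random walk -/

/-- The maximum of the partial sums `0, a 0, …, a 0 + ⋯ + a (k - 1)`, defined through the first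
step of the walk. -/
noncomputable def walkMax : ℕ → (ℕ → ℝ) → ℝ
  | 0, _ => 0
  | k + 1, a => max 0 (a 0 + walkMax k fun i => a (i + 1))

lemma measurable_walkMax (k : ℕ) : Measurable (walkMax k) := by
  induction k with
  | zero => exact measurable_const
  | succ k ih =>
    refine measurable_const.max ((measurable_pi_apply 0).add (ih.comp ?_))
    exact measurable_pi_iff.2 fun i => measurable_pi_apply (i + 1)

lemma lt_walkMax_iff (k : ℕ) (a : ℕ → ℝ) (x : ℝ) :
    x < walkMax k a ↔ ∃ j ≤ k, x < ∑ i ∈ Finset.range j, a i := by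
  induction k generalizing a x with
  | zero => simp [walkMax]
  | succ k ih =>
    have h := ih (fun i => a (i + 1)) (x - a 0)
    rw [walkMax, lt_max_iff, ← sub_lt_iff_lt_add', h]
    constructor
    · rintro (h0 | ⟨j, hj, hlt⟩)
      · exact ⟨0, by simp, by simpa using h0⟩
      · refine ⟨j + 1, by omega, ?_⟩
        rw [Finset.sum_range_succ']
        linarith
    · rintro ⟨j, hj, hlt⟩
      cases j with
      | zero => exact Or.inl (by simpa using hlt)
      | succ j =>
        rw [Finset.sum_range_succ'] at hlt
        exact Or.inr ⟨j, by omega, by linarith⟩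

/-- The event, for a sequence of claims `p.1` and a sequence of waiting times `p.2`, that the
aggregate loss `∑_{i < j} (p.1 i - c p.2 i)` exceeds `x` for some `j ≤ k`. -/
def crossingEvent (c : ℝ) (k : ℕ) (x : ℝ) : Set ((ℕ → ℝ) × (ℕ → ℝ)) :=
  {p | x < walkMax k fun i => p.1 i - c * p.2 i}

lemma measurableSet_crossingEvent (c : ℝ) (k : ℕ) (x : ℝ) :
    MeasurableSet (crossingEvent c k x) := by
  refine measurableSet_lt measurable_const ((measurable_walkMax k).comp ?_)
  exact measurable_pi_iff.2 fun i => by fun_prop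

lemma monotone_crossingEvent (c x : ℝ) : Monotone fun k => crossingEvent c k x := by
  intro k l hkl p hp
  simp only [crossingEvent, Set.mem_ofPred_eq, lt_walkMax_iff] at hp ⊢
  obtain ⟨j, hj, h⟩ := hp
  exact ⟨j, hj.trans hkl, h⟩

/-- The joint law of an i.i.d. sequence of claims with law `η` and an independent i.i.d. sequence
of waiting times with law `τ`. -/
noncomputable def pathLaw (η τ : Measure ℝ) : Measure ((ℕ → ℝ) × (ℕ → ℝ)) :=
  (Measure.infinitePi fun _ : ℕ => η).prod (Measure.infinitePi fun _ : ℕ => τ)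

instance (η τ : Measure ℝ) [IsProbabilityMeasure η] [IsProbabilityMeasure τ] :
    IsProbabilityMeasure (pathLaw η τ) := by
  unfold pathLaw; infer_instance

lemma pathLaw_crossingEvent_of_neg (η τ : Measure ℝ) [IsProbabilityMeasure η]
    [IsProbabilityMeasure τ] (c : ℝ) (k : ℕ) {x : ℝ} (hx : x < 0) :
    pathLaw η τ (crossingEvent c k x) = 1 := by
  have : crossingEvent c k x = Set.univ := by
    refine Set.eq_univ_of_forall fun p => ?_
    simp only [crossingEvent, Set.mem_ofPred_eq, lt_walkMax_iff]
    exact ⟨0, by simp, by simpa using hx⟩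
  rw [this, measure_univ]

lemma pathLaw_crossingEvent_zero (η τ : Measure ℝ) (c : ℝ) {x : ℝ} (hx : 0 ≤ x) :
    pathLaw η τ (crossingEvent c 0 x) = 0 := by
  have : crossingEvent c 0 x = ∅ := by
    refine Set.eq_empty_of_forall_notMem fun p => ?_
    simpa [crossingEvent, walkMax] using hx
  rw [this, measure_empty]

/-- Renewal equation: conditioning on the first claim `z` and the first waiting time `t` turns
the initial level `x` into `x - z + c t`. -/
lemma pathLaw_crossingEvent_succ (η τ : Measure ℝ) [IsProbabilityMeasure η]
    [IsProbabilityMeasure τ] (c : ℝ) (k : ℕ) {x : ℝ} (hx : 0 ≤ x) :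
    pathLaw η τ (crossingEvent c (k + 1) x) =
      ∫⁻ t, ∫⁻ z, pathLaw η τ (crossingEvent c k (x - z + c * t)) ∂η ∂τ := by
  have key : ∀ z z' t t', (consSeq (z, z'), consSeq (t, t')) ∈ crossingEvent c (k + 1) x ↔
      (z', t') ∈ crossingEvent c k (x - z + c * t) := by
    intro z z' t t'
    simp only [crossingEvent, Set.mem_ofPred_eq, walkMax, consSeq, lt_max_iff, not_lt.2 hx,
      false_or]
    constructor <;> intro h <;> linarith
  have hind : ∀ l y, pathLaw η τ (crossingEvent c l y) =
      ∫⁻ z, ∫⁻ t, (crossingEvent c l y).indicator 1 (z, t)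
        ∂(Measure.infinitePi fun _ : ℕ => τ) ∂(Measure.infinitePi fun _ : ℕ => η) := by
    intro l y
    have hm : Measurable ((crossingEvent c l y).indicator (1 : (ℕ → ℝ) × (ℕ → ℝ) → ℝ≥0∞)) :=
      measurable_one.indicator (measurableSet_crossingEvent c l y)
    rw [← lintegral_indicator_one (measurableSet_crossingEvent c l y), pathLaw,
      lintegral_prod _ hm.aemeasurable]
  have hm : Measurable ((crossingEvent c (k + 1) x).indicator (1 : (ℕ → ℝ) × (ℕ → ℝ) → ℝ≥0∞)) :=
    measurable_one.indicator (measurableSet_crossingEvent c (k + 1) x)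
  have hmc := measurable_consSeq (α := ℝ)
  have hm4 : Measurable fun q : (ℝ × (ℕ → ℝ)) × ℝ × (ℕ → ℝ) =>
      (crossingEvent c (k + 1) x).indicator (1 : (ℕ → ℝ) × (ℕ → ℝ) → ℝ≥0∞)
        (consSeq q.1, consSeq q.2) :=
    hm.comp ((hmc.comp measurable_fst).prodMk (hmc.comp measurable_snd))
  rw [hind, lintegral_infinitePi_eq_lintegral_consSeq η hm.lintegral_prod_right']
  have h1 : ∀ z, ∫⁻ z', ∫⁻ t, (crossingEvent c (k + 1) x).indicator 1 (consSeq (z, z'), t)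
        ∂(Measure.infinitePi fun _ : ℕ => τ) ∂(Measure.infinitePi fun _ : ℕ => η) =
      ∫⁻ t, pathLaw η τ (crossingEvent c k (x - z + c * t)) ∂τ := by
    intro z
    have h2 : ∀ z', ∫⁻ t, (crossingEvent c (k + 1) x).indicator (1 : (ℕ → ℝ) × (ℕ → ℝ) → ℝ≥0∞)
          (consSeq (z, z'), t) ∂(Measure.infinitePi fun _ : ℕ => τ) =
        ∫⁻ t, ∫⁻ t', (crossingEvent c (k + 1) x).indicator (1 : (ℕ → ℝ) × (ℕ → ℝ) → ℝ≥0∞)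
          (consSeq (z, z'), consSeq (t, t')) ∂(Measure.infinitePi fun _ : ℕ => τ) ∂τ :=
      fun z' => lintegral_infinitePi_eq_lintegral_consSeq τ (hm.comp measurable_prodMk_left)
    simp_rw [h2]
    rw [lintegral_lintegral_swap]
    · refine lintegral_congr fun t => ?_
      rw [hind]
      refine lintegral_congr fun z' => lintegral_congr fun t' => ?_
      by_cases h : (z', t') ∈ crossingEvent c k (x - z + c * t)
      · rw [Set.indicator_of_mem h, Set.indicator_of_mem ((key z z' t t').2 h)]; rfl
      · rw [Set.indicator_of_notMem h, Set.indicator_of_notMem (fun h' => h ((key z z' t t').1 h'))]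
    · refine Measurable.aemeasurable ?_
      have : Measurable fun q : ((ℕ → ℝ) × ℝ) × (ℕ → ℝ) =>
          (crossingEvent c (k + 1) x).indicator (1 : (ℕ → ℝ) × (ℕ → ℝ) → ℝ≥0∞)
            (consSeq (z, q.1.1), consSeq (q.1.2, q.2)) :=
        hm4.comp (by fun_prop : Measurable fun q : ((ℕ → ℝ) × ℝ) × (ℕ → ℝ) =>
          ((z, q.1.1), (q.1.2, q.2)))
      exact this.lintegral_prod_right'
  simp_rw [h1]
  rw [lintegral_lintegral_swap]
  refine Measurable.aemeasurable ?_
  have hS : MeasurableSet {q : (ℝ × ℝ) × ((ℕ → ℝ) × (ℕ → ℝ)) |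
      q.2 ∈ crossingEvent c k (x - q.1.1 + c * q.1.2)} := by
    refine measurableSet_lt (by fun_prop) ((measurable_walkMax k).comp ?_)
    exact measurable_pi_iff.2 fun i => by fun_prop
  exact measurable_measure_prodMk_left hS

/-! ### Exponential bounds for the crossing probabilities -/

/-- The moment generating function at `s` of one step `z - c t` of the walk, where `z` has law `η`
and `t` has law `τ`, with values in `[0, ∞]`. -/
noncomputable def stepMGF (η τ : Measure ℝ) (c s : ℝ) : ℝ≥0∞ :=
  (∫⁻ z, ENNReal.ofReal (Real.exp (s * z)) ∂η) *
    ∫⁻ t, ENNReal.ofReal (Real.exp (-(s * c * t))) ∂τ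

lemma lintegral_exp_neg_sub (η : Measure ℝ) (s y : ℝ) :
    ∫⁻ z, ENNReal.ofReal (Real.exp (-(s * (y - z)))) ∂η =
      ENNReal.ofReal (Real.exp (-(s * y))) * ∫⁻ z, ENNReal.ofReal (Real.exp (s * z)) ∂η := by
  rw [← lintegral_const_mul _ (by fun_prop)]
  refine lintegral_congr fun z => ?_
  rw [← ENNReal.ofReal_mul (Real.exp_nonneg _), ← Real.exp_add]
  congr 2; ring

lemma lintegral_exp_step (η τ : Measure ℝ) (c s x : ℝ) :
    ∫⁻ t, ∫⁻ z, ENNReal.ofReal (Real.exp (-(s * (x - z + c * t)))) ∂η ∂τ =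
      ENNReal.ofReal (Real.exp (-(s * x))) * stepMGF η τ c s := by
  have h : ∀ t, ∫⁻ z, ENNReal.ofReal (Real.exp (-(s * (x - z + c * t)))) ∂η =
      (ENNReal.ofReal (Real.exp (-(s * x))) * ∫⁻ z, ENNReal.ofReal (Real.exp (s * z)) ∂η) *
        ENNReal.ofReal (Real.exp (-(s * c * t))) := by
    intro t
    have h1 := lintegral_exp_neg_sub η s (x + c * t)
    have h2 : ENNReal.ofReal (Real.exp (-(s * (x + c * t)))) =
        ENNReal.ofReal (Real.exp (-(s * x))) * ENNReal.ofReal (Real.exp (-(s * c * t))) := by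
      rw [← ENNReal.ofReal_mul (Real.exp_nonneg _), ← Real.exp_add]
      congr 2; ring
    rw [h2] at h1
    rw [mul_right_comm, ← h1]
    refine lintegral_congr fun z => ?_
    congr 3; ring
  simp_rw [h]
  rw [lintegral_const_mul _ (by fun_prop), stepMGF, mul_assoc]

/-- Lundberg's inequality, for every exponent at which the step has moment generating function at
most one. -/
lemma pathLaw_crossingEvent_le (η τ : Measure ℝ) [IsProbabilityMeasure η] [IsProbabilityMeasure τ]
    {c s : ℝ} (hs : 0 ≤ s) (hmgf : stepMGF η τ c s ≤ 1) (k : ℕ) (x : ℝ) :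
    pathLaw η τ (crossingEvent c k x) ≤ ENNReal.ofReal (Real.exp (-(s * x))) := by
  induction k generalizing x with
  | zero =>
    rcases lt_or_ge x 0 with hx | hx
    · rw [pathLaw_crossingEvent_of_neg η τ c _ hx, ENNReal.one_le_ofReal]
      exact Real.one_le_exp (by nlinarith)
    · rw [pathLaw_crossingEvent_zero η τ c hx]; exact zero_le
  | succ k ih =>
    rcases lt_or_ge x 0 with hx | hx
    · rw [pathLaw_crossingEvent_of_neg η τ c _ hx, ENNReal.one_le_ofReal]
      exact Real.one_le_exp (by nlinarith)
    · rw [pathLaw_crossingEvent_succ η τ c k hx]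
      calc _ ≤ ∫⁻ t, ∫⁻ z, ENNReal.ofReal (Real.exp (-(s * (x - z + c * t)))) ∂η ∂τ :=
            lintegral_mono fun t => lintegral_mono fun z => ih _
        _ ≤ _ := by
            rw [lintegral_exp_step]
            exact mul_le_of_le_one_right' hmgf

/-- The function equal to `1` on the negative half-line and to `e^{-g x} / K` elsewhere; it is a
lower bound for crossing probabilities when `K` dominates the exponential moment of the
overshoot. -/
noncomputable def overshootBarrier (g : ℝ) (K : ℝ≥0∞) (x : ℝ) : ℝ≥0∞ :=
  if x < 0 then 1 else K⁻¹ * ENNReal.ofReal (Real.exp (-(g * x)))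

lemma inv_mul_lintegral_exp_le_overshootBarrier (η : Measure ℝ) {g y : ℝ} {K : ℝ≥0∞} (hK0 : K ≠ 0)
    (hK : K ≠ ∞)
    (hover : ∫⁻ z in Set.Ioi y, ENNReal.ofReal (Real.exp (g * (z - y))) ∂η ≤ K * η (Set.Ioi y)) :
    K⁻¹ * ∫⁻ z, ENNReal.ofReal (Real.exp (-(g * (y - z)))) ∂η ≤
      ∫⁻ z, overshootBarrier g K (y - z) ∂η := by
  rw [← lintegral_add_compl _ (measurableSet_Ioi (a := y)),
    ← lintegral_add_compl (fun z => overshootBarrier g K (y - z)) (measurableSet_Ioi (a := y)),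
    mul_add]
  refine add_le_add ?_ ?_
  · have h1 : ∫⁻ z in Set.Ioi y, overshootBarrier g K (y - z) ∂η = η (Set.Ioi y) := by
      rw [setLIntegral_congr_fun (g := fun _ => 1) measurableSet_Ioi]
      · simp
      · intro z hz
        exact if_pos (sub_neg.2 hz)
    have h2 : ∀ z, -(g * (y - z)) = g * (z - y) := fun z => by ring
    simp_rw [h1, h2]
    calc _ ≤ K⁻¹ * (K * η (Set.Ioi y)) := by gcongr
      _ = _ := by rw [← mul_assoc, ENNReal.inv_mul_cancel hK0 hK, one_mul]
  · rw [← lintegral_const_mul _ (by fun_prop)]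
    refine le_of_eq (setLIntegral_congr_fun measurableSet_Ioi.compl fun z hz => ?_)
    exact (if_neg (by simpa using hz)).symm

/-- Lower bound for the crossing probabilities. The last summand bounds the contribution of the
paths that have not crossed after `k` steps; it vanishes as `k → ∞` when the moment generating
function of the step at `a` is less than one. -/
lemma overshootBarrier_le_pathLaw_crossingEvent (η τ : Measure ℝ) [IsProbabilityMeasure η]
    [IsProbabilityMeasure τ] {c g a : ℝ} {K : ℝ≥0∞} (hK1 : 1 ≤ K) (hK : K ≠ ∞)
    (hc : 0 ≤ c) (hτ : ∀ᵐ t ∂τ, 0 ≤ t) (hag : a ≤ g) (hmgf : 1 ≤ stepMGF η τ c g)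
    (hover : ∀ y, 0 ≤ y →
      ∫⁻ z in Set.Ioi y, ENNReal.ofReal (Real.exp (g * (z - y))) ∂η ≤ K * η (Set.Ioi y))
    (k : ℕ) (x : ℝ) :
    overshootBarrier g K x ≤ pathLaw η τ (crossingEvent c k x) +
      stepMGF η τ c a ^ k * ENNReal.ofReal (Real.exp (-(a * x))) := by
  have hK0 : K ≠ 0 := (zero_lt_one.trans_le hK1).ne'
  induction k generalizing x with
  | zero =>
    rcases lt_or_ge x 0 with hx | hx
    · rw [pathLaw_crossingEvent_of_neg η τ c _ hx, overshootBarrier, if_pos hx]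
      exact le_self_add
    · rw [overshootBarrier, if_neg hx.not_gt, pow_zero, one_mul]
      refine le_add_left ?_
      calc _ ≤ 1 * ENNReal.ofReal (Real.exp (-(a * x))) := by
            gcongr
            exact ENNReal.inv_le_one.2 hK1
        _ = _ := one_mul _
  | succ k ih =>
    rcases lt_or_ge x 0 with hx | hx
    · rw [pathLaw_crossingEvent_of_neg η τ c _ hx, overshootBarrier, if_pos hx]
      exact le_self_add
    · have h1 : overshootBarrier g K x ≤
          ∫⁻ t, ∫⁻ z, overshootBarrier g K (x - z + c * t) ∂η ∂τ := by
        calc overshootBarrier g K x = K⁻¹ * (ENNReal.ofReal (Real.exp (-(g * x))) * 1) := by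
              rw [overshootBarrier, if_neg hx.not_gt, mul_one]
          _ ≤ K⁻¹ * (ENNReal.ofReal (Real.exp (-(g * x))) * stepMGF η τ c g) := by gcongr
          _ = ∫⁻ t, K⁻¹ * ∫⁻ z, ENNReal.ofReal (Real.exp (-(g * (x - z + c * t)))) ∂η ∂τ := by
              rw [← lintegral_exp_step, lintegral_const_mul']
              exact ENNReal.inv_ne_top.2 hK0
          _ ≤ _ := by
              refine lintegral_mono_ae ?_
              filter_upwards [hτ] with t ht
              have hy : 0 ≤ x + c * t := by positivity
              have h := inv_mul_lintegral_exp_le_overshootBarrier η hK0 hK (hover _ hy)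
              simpa only [sub_add_eq_add_sub] using h
      refine h1.trans ?_
      calc _ ≤ ∫⁻ t, ∫⁻ z, (pathLaw η τ (crossingEvent c k (x - z + c * t)) +
              stepMGF η τ c a ^ k * ENNReal.ofReal (Real.exp (-(a * (x - z + c * t))))) ∂η ∂τ :=
            lintegral_mono fun t => lintegral_mono fun z => ih _
        _ = _ := by
            have hm : Measurable fun q : ℝ × ℝ =>
                stepMGF η τ c a ^ k * ENNReal.ofReal (Real.exp (-(a * (x - q.2 + c * q.1)))) := by
              fun_prop
            have hmt : ∀ t, Measurable fun z : ℝ =>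
                stepMGF η τ c a ^ k * ENNReal.ofReal (Real.exp (-(a * (x - z + c * t)))) :=
              fun t => by fun_prop
            simp_rw [fun t => lintegral_add_right (μ := η)
              (fun z => pathLaw η τ (crossingEvent c k (x - z + c * t))) (hmt t)]
            rw [lintegral_add_right _ hm.lintegral_prod_right',
              ← pathLaw_crossingEvent_succ η τ c k hx]
            congr 1
            simp_rw [fun t : ℝ => lintegral_const_mul (μ := η) (stepMGF η τ c a ^ k)
              (by fun_prop : Measurable fun z : ℝ =>
                ENNReal.ofReal (Real.exp (-(a * (x - z + c * t)))))]
            rw [lintegral_const_mul _ (by fun_prop), lintegral_exp_step, pow_succ]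
            ring

/-- The Laplace transform of the exponential distribution. -/
lemma lintegral_exp_neg_expMeasure {r s : ℝ} (hr : 0 < r) (hs : 0 ≤ s) :
    ∫⁻ t, ENNReal.ofReal (Real.exp (-(s * t))) ∂(expMeasure r) = ENNReal.ofReal (r / (r + s)) := by
  have hdens : expMeasure r = volume.withDensity (exponentialPDF r) := rfl
  have hmeas : ∀ q, Measurable (exponentialPDF q) := fun q =>
    (measurable_exponentialPDFReal q).ennreal_ofReal
  rw [hdens, lintegral_withDensity_eq_lintegral_mul _ (hmeas r) (by fun_prop)]
  have h : ∀ t, (exponentialPDF r * fun t => ENNReal.ofReal (Real.exp (-(s * t)))) t =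
      ENNReal.ofReal (r / (r + s)) * exponentialPDF (r + s) t := by
    intro t
    simp only [Pi.mul_apply, exponentialPDF_eq]
    rw [← ENNReal.ofReal_mul (by split_ifs <;> positivity), ← ENNReal.ofReal_mul (by positivity)]
    congr 1
    split_ifs
    · rw [mul_assoc, ← Real.exp_add, ← mul_assoc, div_mul_cancel₀ _ (by positivity)]
      congr 2; ring
    · simp
  simp_rw [h]
  rw [lintegral_const_mul _ (hmeas _), lintegral_exponentialPDF_eq_one (by positivity), mul_one]

lemma ae_nonneg_expMeasure (r : ℝ) : ∀ᵐ t ∂(expMeasure r), 0 ≤ t := by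
  have hdens : expMeasure r = volume.withDensity (exponentialPDF r) := rfl
  have hmeas : Measurable (exponentialPDF r) := (measurable_exponentialPDFReal r).ennreal_ofReal
  rw [hdens, ae_withDensity_iff hmeas]
  refine Filter.Eventually.of_forall fun t ht => ?_
  by_contra h
  exact ht (exponentialPDF_of_neg (not_le.1 h))

/-! ### From the Cramér–Lundberg model to a random walk -/

/-- The time at which the counting path `p` reaches the level `k`. The infimum runs over rational
times only, so that it is a measurable function of the path. -/
noncomputable def arrivalTime (k : ℕ) (p : ℝ≥0 → ℕ) : ℝ≥0∞ :=
  ⨅ q : ℚ≥0, if k ≤ p q then ((q : ℝ≥0) : ℝ≥0∞) else ∞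

lemma measurable_arrivalTime (k : ℕ) : Measurable (arrivalTime k) := by
  refine Measurable.iInf fun q => Measurable.ite ?_ measurable_const measurable_const
  exact measurable_pi_apply (q : ℝ≥0) (measurableSet_Ici (a := k))

lemma arrivalTime_eq {k : ℕ} {p : ℝ≥0 → ℕ} {s : ℝ≥0} (h : ∀ t, k ≤ p t ↔ s ≤ t) :
    arrivalTime k p = s := by
  refine le_antisymm ?_ (le_iInf fun q => ?_)
  · refine ENNReal.le_of_forall_pos_le_add fun ε hε _ => ?_
    obtain ⟨q, hsq, hqε⟩ := exists_rat_btwn (show (s : ℝ) < s + ε by simpa using hε)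
    have hq0 : 0 ≤ q := by exact_mod_cast s.2.trans hsq.le
    lift q to ℚ≥0 using hq0
    have h1 : s ≤ (q : ℝ≥0) := by
      exact_mod_cast hsq.le
    have h2 : (q : ℝ≥0) ≤ s + ε := by
      exact_mod_cast hqε.le
    refine (iInf_le _ q).trans ?_
    rw [if_pos ((h _).2 h1)]
    exact_mod_cast h2
  · split_ifs with hq
    · exact_mod_cast (h _).1 hq
    · exact le_top

/-- The waiting times are almost surely measurable functions of the path of the Poisson process;
hence they are independent of everything that is independent of the process. -/
lemma ae_eq_arrivalTime_sub {Ω : Type*} [MeasurableSpace Ω] {P : Measure Ω}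
    {N : ℝ≥0 → Ω → ℕ} {T : ℕ → Ω → ℝ} (hT0 : ∀ᵐ ω ∂P, ∀ i, 0 ≤ T i ω)
    (hTN : ∀ᵐ ω ∂P, ∀ (t : ℝ≥0) (k : ℕ), k ≤ N t ω ↔ ∑ i ∈ Finset.range k, T i ω ≤ (t : ℝ)) :
    (fun ω i => (arrivalTime (i + 1) fun t => N t ω).toReal -
      (arrivalTime i fun t => N t ω).toReal) =ᵐ[P] fun ω i => T i ω := by
  filter_upwards [hT0, hTN] with ω h0 hN
  have harr : ∀ k, (arrivalTime k fun t => N t ω).toReal = ∑ i ∈ Finset.range k, T i ω := by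
    intro k
    have hs : 0 ≤ ∑ i ∈ Finset.range k, T i ω := Finset.sum_nonneg fun i _ => h0 i
    rw [arrivalTime_eq (s := NNReal.mk _ hs) fun t => ?_]
    · rfl
    · rw [hN t k, ← NNReal.coe_le_coe]; rfl
  funext i
  rw [harr, harr, Finset.sum_range_succ, add_sub_cancel_left]

lemma ruinTime_lt_top_iff {Ω : Type*} (X : ℝ≥0 → Ω → ℝ) (ω : Ω) :
    ruinTime X ω < ∞ ↔ ∃ t, X t ω < 0 := by
  simp [ruinTime, iInf_lt_iff]

/-- Between two claims the surplus grows, so ruin happens if and only if the random walk with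
steps `Y i - c T i` exceeds `x`. -/
lemma exists_surplus_neg_iff {Ω : Type*} {x c : ℝ} (hc : 0 ≤ c) {N : ℝ≥0 → Ω → ℕ}
    {Y : ℕ → Ω → ℝ} {T : ℕ → Ω → ℝ} {ω : Ω} (hY : ∀ i, 0 ≤ Y i ω) (hT : ∀ i, 0 ≤ T i ω)
    (hN : ∀ (t : ℝ≥0) (k : ℕ), k ≤ N t ω ↔ ∑ i ∈ Finset.range k, T i ω ≤ (t : ℝ)) :
    (∃ t, surplus x c N Y t ω < 0) ↔
      ∃ k, x < ∑ i ∈ Finset.range k, (Y i ω - c * T i ω) := by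
  simp only [surplus, Finset.sum_sub_distrib, ← Finset.mul_sum]
  constructor
  · rintro ⟨t, ht⟩
    have h := mul_le_mul_of_nonneg_left ((hN t (N t ω)).1 le_rfl) hc
    exact ⟨N t ω, by linarith⟩
  · rintro ⟨k, hk⟩
    have hs : 0 ≤ ∑ i ∈ Finset.range k, T i ω := Finset.sum_nonneg fun i _ => hT i
    refine ⟨NNReal.mk _ hs, ?_⟩
    have hkN : k ≤ N (NNReal.mk _ hs) ω := (hN _ k).2 le_rfl
    have hsum : ∑ i ∈ Finset.range k, Y i ω ≤ ∑ i ∈ Finset.range (N (NNReal.mk _ hs) ω), Y i ω :=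
      Finset.sum_le_sum_of_subset_of_nonneg (Finset.range_mono hkN) fun i _ _ => hY i
    rw [NNReal.coe_mk]
    linarith

/-- The model enters the ruin probability only through the law of the claims and of the waiting
times: ultimate ruin has the probability that the random walk ever exceeds `x`. -/
lemma measure_ruinTime_lt_top {Ω : Type*} [MeasurableSpace Ω] {P : Measure Ω}
    [IsProbabilityMeasure P] {N : ℝ≥0 → Ω → ℕ} {Y : ℕ → Ω → ℝ} {r c : ℝ} {η : Measure ℝ}
    [IsProbabilityMeasure η] (hr : 0 < r) (hc : 0 ≤ c) (hη : ∀ᵐ z ∂η, 0 ≤ z)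
    (hM : IsCramerLundberg N Y r η P) (x : ℝ) :
    P {ω | ruinTime (surplus x c N Y) ω < ∞} =
      ⨆ k, pathLaw η (expMeasure r) (crossingEvent c k x) := by
  have := isProbabilityMeasure_expMeasure hr
  obtain ⟨T, hTlaw, hTind, hTN⟩ := hM.poisson.exists_interarrival
  have hT0 : ∀ᵐ ω ∂P, ∀ i, 0 ≤ T i ω := ae_all_iff.2 fun i =>
    ((hTlaw i).ae_iff (p := fun t => 0 ≤ t) (measurableSet_Ici (a := (0 : ℝ))).mem).2
      (ae_nonneg_expMeasure r)
  have hY0 : ∀ᵐ ω ∂P, ∀ i, 0 ≤ Y i ω := ae_all_iff.2 fun i =>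
    ((hM.law_claim i).ae_iff (p := fun t => 0 ≤ t) (measurableSet_Ici (a := (0 : ℝ))).mem).2 hη
  have hTm : AEMeasurable (fun ω i => T i ω) P :=
    aemeasurable_pi_iff.2 fun i => (hTlaw i).aemeasurable
  have hYm : AEMeasurable (fun ω i => Y i ω) P :=
    aemeasurable_pi_iff.2 fun i => (hM.law_claim i).aemeasurable
  have hind : IndepFun (fun ω i => Y i ω) (fun ω i => T i ω) P := by
    have hφ : Measurable fun (p : ℝ≥0 → ℕ) (i : ℕ) =>
        (arrivalTime (i + 1) p).toReal - (arrivalTime i p).toReal :=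
      measurable_pi_iff.2 fun i =>
        (measurable_arrivalTime (i + 1)).ennreal_toReal.sub (measurable_arrivalTime i).ennreal_toReal
    exact (hM.indepFun_claim_poisson.comp measurable_id hφ).congr (Filter.EventuallyEq.refl _ _)
      (ae_eq_arrivalTime_sub hT0 hTN)
  have hlaw : P.map (fun ω => ((fun i => Y i ω), fun i => T i ω)) = pathLaw η (expMeasure r) := by
    rw [(indepFun_iff_map_prod_eq_prod_map_map hYm hTm).1 hind,
      (hM.iIndepFun_claim.hasLaw_infinitePi hM.law_claim hYm).map_eq,
      (hTind.hasLaw_infinitePi hTlaw hTm).map_eq, pathLaw]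
  have hev : {ω | ruinTime (surplus x c N Y) ω < ∞} =ᵐ[P]
      (fun ω => ((fun i => Y i ω), fun i => T i ω)) ⁻¹' ⋃ k, crossingEvent c k x := by
    filter_upwards [hT0, hY0, hTN] with ω hT hY hN
    refine propext ?_
    change ruinTime (surplus x c N Y) ω < ∞ ↔ _ ∈ ⋃ k, crossingEvent c k x
    rw [ruinTime_lt_top_iff, exists_surplus_neg_iff hc hY hT hN]
    simp only [Set.mem_iUnion, crossingEvent, Set.mem_ofPred_eq, lt_walkMax_iff]
    exact ⟨fun ⟨k, hk⟩ => ⟨k, k, le_rfl, hk⟩, fun ⟨_, j, _, hj⟩ => ⟨j, hj⟩⟩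
  rw [measure_congr hev, ← Measure.map_apply_of_aemeasurable (hYm.prodMk hTm)
    (MeasurableSet.iUnion fun k => measurableSet_crossingEvent c k x), hlaw,
    (monotone_crossingEvent c x).measure_iUnion]

/-- Two-sided bound for the probability of ultimate ruin, in terms of an exponent `s` at which the
step of the random walk has moment generating function less than one, an exponent `g ≥ s` at which
it is at least one, and a bound `K` for the exponential moments of the overshoot. -/
lemma ruinProb_bounds {Ω : Type*} [MeasurableSpace Ω] {P : Measure Ω}
    [IsProbabilityMeasure P] {N : ℝ≥0 → Ω → ℕ} {Y : ℕ → Ω → ℝ} {r c : ℝ} {η : Measure ℝ}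
    [IsProbabilityMeasure η] (hr : 0 < r) (hc : 0 ≤ c) (hη : ∀ᵐ z ∂η, 0 ≤ z)
    (hM : IsCramerLundberg N Y r η P) {s g K : ℝ} (hs : 0 ≤ s) (hsg : s ≤ g) (hK : 1 ≤ K)
    (hmgfs : stepMGF η (expMeasure r) c s < 1) (hmgfg : 1 ≤ stepMGF η (expMeasure r) c g)
    (hover : ∀ y, 0 ≤ y → ∫⁻ z in Set.Ioi y, ENNReal.ofReal (Real.exp (g * (z - y))) ∂η ≤
      ENNReal.ofReal K * η (Set.Ioi y)) {x : ℝ} (hx : 0 ≤ x) :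
    Real.exp (-(g * x)) / K ≤ ruinProb P N Y c x ∧
      ruinProb P N Y c x ≤ Real.exp (-(s * x)) := by
  have := isProbabilityMeasure_expMeasure hr
  have hP := measure_ruinTime_lt_top hr hc hη hM x
  rw [ruinProb, measureReal_def]
  constructor
  · have hlow : overshootBarrier g (ENNReal.ofReal K) x ≤
        P {ω | ruinTime (surplus x c N Y) ω < ∞} := by
      have hlim : Filter.Tendsto (fun k : ℕ => P {ω | ruinTime (surplus x c N Y) ω < ∞} +
          stepMGF η (expMeasure r) c s ^ k * ENNReal.ofReal (Real.exp (-(s * x)))) Filter.atTop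
          (nhds (P {ω | ruinTime (surplus x c N Y) ω < ∞} +
            0 * ENNReal.ofReal (Real.exp (-(s * x))))) :=
        tendsto_const_nhds.add (ENNReal.Tendsto.mul_const
          (ENNReal.tendsto_pow_atTop_nhds_zero_of_lt_one hmgfs) (Or.inr ENNReal.ofReal_ne_top))
      rw [zero_mul, add_zero] at hlim
      refine ge_of_tendsto' hlim fun k => ?_
      refine (overshootBarrier_le_pathLaw_crossingEvent η (expMeasure r) (a := s)
        (ENNReal.one_le_ofReal.2 hK) ENNReal.ofReal_ne_top hc (ae_nonneg_expMeasure r) hsg hmgfg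
        hover k x).trans (add_le_add_left ?_ _)
      rw [hP]
      exact le_iSup (fun k => pathLaw η (expMeasure r) (crossingEvent c k x)) k
    have h := ENNReal.toReal_mono (measure_ne_top _ _) hlow
    rwa [overshootBarrier, if_neg hx.not_gt, ENNReal.toReal_mul, ENNReal.toReal_inv,
      ENNReal.toReal_ofReal (by linarith), ENNReal.toReal_ofReal (Real.exp_nonneg _),
      mul_comm, ← div_eq_mul_inv] at h
  · refine ENNReal.toReal_le_of_le_ofReal (Real.exp_nonneg _) ?_
    rw [hP]
    exact iSup_le fun k => pathLaw_crossingEvent_le η (expMeasure r) hs hmgfs.le k x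

/-! ### Expansion of the moment generating function of a claim -/

lemma exp_le_quadratic_add_cube_mul_exp {w : ℝ} (hw : 0 ≤ w) :
    Real.exp w ≤ 1 + w + w ^ 2 / 2 + w ^ 3 * Real.exp w := by
  have he := Real.one_le_exp hw
  rcases le_total w 1 with h | h
  · have h1 := Real.exp_bound' hw h (n := 3) (by norm_num)
    norm_num [Finset.sum_range_succ, Nat.factorial] at h1
    have h3 : 0 ≤ w ^ 3 := by positivity
    nlinarith
  · have h1 : 1 * Real.exp w ≤ w ^ 3 * Real.exp w := by
      gcongr
      exact one_le_pow₀ h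
    nlinarith

lemma quadratic_le_integral_exp {ν : Measure ℝ} [IsProbabilityMeasure ν]
    (hpos : ∀ᵐ y ∂ν, 0 < y) (h1 : Integrable (fun y : ℝ => y) ν)
    (h2 : Integrable (fun y : ℝ => y ^ 2) ν) {u : ℝ} (hu : 0 ≤ u)
    (he : Integrable (fun y => Real.exp (u * y)) ν) :
    1 + u * ∫ y, y ∂ν + u ^ 2 / 2 * ∫ y, y ^ 2 ∂ν ≤ ∫ y, Real.exp (u * y) ∂ν := by
  have hi1 : Integrable (fun y : ℝ => 1 + u * y) ν := (integrable_const _).add (h1.const_mul u)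
  have hi2 : Integrable (fun y : ℝ => u ^ 2 / 2 * y ^ 2) ν := h2.const_mul _
  have heq : ∫ y, (1 + u * y + u ^ 2 / 2 * y ^ 2) ∂ν =
      1 + u * ∫ y, y ∂ν + u ^ 2 / 2 * ∫ y, y ^ 2 ∂ν := by
    rw [integral_add hi1 hi2, integral_add (integrable_const _) (h1.const_mul u),
      integral_const_mul, integral_const_mul]
    simp
  rw [← heq]
  refine integral_mono_ae (hi1.add hi2) he ?_
  filter_upwards [hpos] with y hy
  have := Real.quadratic_le_exp_of_nonneg (x := u * y) (by positivity)
  nlinarith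

lemma integral_exp_le_cubic {ν : Measure ℝ} [IsProbabilityMeasure ν]
    (hpos : ∀ᵐ y ∂ν, 0 < y) (h1 : Integrable (fun y : ℝ => y) ν)
    (h2 : Integrable (fun y : ℝ => y ^ 2) ν) {u v : ℝ} (hu : 0 ≤ u) (huv : u ≤ v)
    (he : Integrable (fun y => Real.exp (u * y)) ν)
    (h3 : Integrable (fun y => y ^ 3 * Real.exp (v * y)) ν) :
    ∫ y, Real.exp (u * y) ∂ν ≤ 1 + u * ∫ y, y ∂ν + u ^ 2 / 2 * ∫ y, y ^ 2 ∂ν +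
      u ^ 3 * ∫ y, y ^ 3 * Real.exp (v * y) ∂ν := by
  have hi1 : Integrable (fun y : ℝ => 1 + u * y) ν := (integrable_const _).add (h1.const_mul u)
  have hi2 : Integrable (fun y : ℝ => u ^ 2 / 2 * y ^ 2) ν := h2.const_mul _
  have hi3 : Integrable (fun y => u ^ 3 * (y ^ 3 * Real.exp (v * y))) ν := h3.const_mul _
  have heq : ∫ y, (1 + u * y + u ^ 2 / 2 * y ^ 2 + u ^ 3 * (y ^ 3 * Real.exp (v * y))) ∂ν =
      1 + u * ∫ y, y ∂ν + u ^ 2 / 2 * ∫ y, y ^ 2 ∂ν +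
        u ^ 3 * ∫ y, y ^ 3 * Real.exp (v * y) ∂ν := by
    have hi12 : Integrable (fun y : ℝ => 1 + u * y + u ^ 2 / 2 * y ^ 2) ν := hi1.add hi2
    rw [integral_add hi12 hi3, integral_add hi1 hi2,
      integral_add (integrable_const _) (h1.const_mul u),
      integral_const_mul, integral_const_mul, integral_const_mul]
    simp
  rw [← heq]
  refine integral_mono_ae he ((hi1.add hi2).add hi3) ?_
  filter_upwards [hpos] with y hy
  have h := exp_le_quadratic_add_cube_mul_exp (w := u * y) (by positivity)
  have h4 : (u * y) ^ 3 * Real.exp (u * y) ≤ (u * y) ^ 3 * Real.exp (v * y) := by gcongr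
  calc Real.exp (u * y) ≤ 1 + u * y + (u * y) ^ 2 / 2 + (u * y) ^ 3 * Real.exp (v * y) := by
        linarith
    _ = _ := by ring

/-! ### Exponential moments of the overshoot -/

lemma exp_mul_le_one_add {u v t : ℝ} (hu : 0 ≤ u) (huv : u ≤ v) (ht : 0 ≤ t) :
    Real.exp (u * t) ≤ (1 + u * Real.exp v) + u * (t ^ 2 * Real.exp (v * t)) := by
  have h1 : Real.exp (u * t) ≤ 1 + u * (t * Real.exp (v * t)) := by
    have h := Real.add_one_le_exp (-(u * t))
    have h2 : Real.exp (u * t) * Real.exp (-(u * t)) = 1 := by rw [← Real.exp_add]; simp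
    have h3 : Real.exp (u * t) ≤ 1 + u * t * Real.exp (u * t) := by
      nlinarith [Real.exp_pos (u * t)]
    have h4 : u * t * Real.exp (u * t) ≤ u * t * Real.exp (v * t) := by gcongr
    nlinarith
  have hv := hu.trans huv
  have h5 : t * Real.exp (v * t) ≤ Real.exp v + t ^ 2 * Real.exp (v * t) := by
    rcases le_total t 1 with h | h
    · have : t * Real.exp (v * t) ≤ 1 * Real.exp (v * 1) := by gcongr
      have h6 : 0 ≤ t ^ 2 * Real.exp (v * t) := by positivity
      simp only [one_mul, mul_one] at this
      linarith
    · have : t * Real.exp (v * t) ≤ t ^ 2 * Real.exp (v * t) := by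
        gcongr
        nlinarith
      linarith [Real.exp_pos v]
  nlinarith [mul_le_mul_of_nonneg_left h5 hu]

/-- The uniform bound on the conditional moments of the overshoot makes its conditional
moment generating function at small `u` at most `1 + O(u)`, uniformly in the level. -/
lemma UniformCondMoment.exists_overshoot_bound {θ : ℝ} {ν : Measure ℝ} [IsProbabilityMeasure ν]
    (h : UniformCondMoment θ ν) :
    ∃ m D : ℝ, 0 < m ∧ 0 ≤ D ∧ ∀ u, 0 ≤ u → u ≤ ruinExponent θ ν / Real.sqrt m → ∀ d, 0 ≤ d →
      ∫⁻ y in Set.Ioi d, ENNReal.ofReal (Real.exp (u * (y - d))) ∂ν ≤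
        ENNReal.ofReal (1 + u * D) * ν (Set.Ioi d) := by
  obtain ⟨m, hm, hS⟩ := h
  set v := ruinExponent θ ν / Real.sqrt m with hv
  set S : ℝ≥0∞ := ⨆ (d : ℝ) (_ : 0 ≤ d), (∫⁻ y, ENNReal.ofReal
      ((y - d) ^ 2 * Real.exp (v * (y - d))) ∂(ProbabilityTheory.cond ν (Set.Ioi d))) with hSdef
  refine ⟨m, Real.exp v + S.toReal, hm, by positivity, fun u hu huv d hd => ?_⟩
  have hmom : ∫⁻ y in Set.Ioi d, ENNReal.ofReal ((y - d) ^ 2 * Real.exp (v * (y - d))) ∂ν ≤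
      S * ν (Set.Ioi d) := by
    rcases eq_or_ne (ν (Set.Ioi d)) 0 with h0 | h0
    · rw [setLIntegral_measure_zero _ _ h0]; exact zero_le
    · have hle : ∫⁻ y, ENNReal.ofReal ((y - d) ^ 2 * Real.exp (v * (y - d)))
          ∂(ProbabilityTheory.cond ν (Set.Ioi d)) ≤ S :=
        le_iSup₂ (f := fun (d : ℝ) (_ : 0 ≤ d) => ∫⁻ y, ENNReal.ofReal
          ((y - d) ^ 2 * Real.exp (v * (y - d))) ∂(ProbabilityTheory.cond ν (Set.Ioi d))) d hd
      rw [ProbabilityTheory.cond, lintegral_smul_measure, smul_eq_mul] at hle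
      calc _ = ν (Set.Ioi d) * ((ν (Set.Ioi d))⁻¹ * ∫⁻ y in Set.Ioi d,
            ENNReal.ofReal ((y - d) ^ 2 * Real.exp (v * (y - d))) ∂ν) := by
            rw [← mul_assoc, ENNReal.mul_inv_cancel h0 (measure_ne_top _ _), one_mul]
        _ ≤ ν (Set.Ioi d) * S := by gcongr
        _ = _ := mul_comm _ _
  have hv0 : 0 ≤ v := hu.trans huv
  calc ∫⁻ y in Set.Ioi d, ENNReal.ofReal (Real.exp (u * (y - d))) ∂ν
      ≤ ∫⁻ y in Set.Ioi d, (ENNReal.ofReal (1 + u * Real.exp v) + ENNReal.ofReal u *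
          ENNReal.ofReal ((y - d) ^ 2 * Real.exp (v * (y - d)))) ∂ν := by
        refine setLIntegral_mono (by fun_prop) fun y hy => ?_
        rw [← ENNReal.ofReal_mul hu, ← ENNReal.ofReal_add (by positivity) (by positivity)]
        exact ENNReal.ofReal_le_ofReal (exp_mul_le_one_add hu huv (sub_nonneg.2 (le_of_lt hy)))
    _ = ENNReal.ofReal (1 + u * Real.exp v) * ν (Set.Ioi d) + ENNReal.ofReal u *
          ∫⁻ y in Set.Ioi d, ENNReal.ofReal ((y - d) ^ 2 * Real.exp (v * (y - d))) ∂ν := by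
        rw [lintegral_add_left measurable_const, setLIntegral_const,
          lintegral_const_mul _ (by fun_prop)]
    _ ≤ ENNReal.ofReal (1 + u * Real.exp v) * ν (Set.Ioi d) +
          ENNReal.ofReal u * (S * ν (Set.Ioi d)) := by gcongr
    _ = ENNReal.ofReal (1 + u * (Real.exp v + S.toReal)) * ν (Set.Ioi d) := by
        rw [← mul_assoc, ← add_mul]
        congr 1
        conv_lhs => rw [← ENNReal.ofReal_toReal hS.ne]
        rw [← ENNReal.ofReal_mul hu, ← ENNReal.ofReal_add (by positivity) (by positivity)]
        congr 1; ring

/-! ### The scaled model -/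

lemma lintegral_scaledClaimLaw (ν : Measure ℝ) (n : ℝ) {f : ℝ → ℝ≥0∞} (hf : Measurable f) :
    ∫⁻ z, f z ∂(scaledClaimLaw ν n) = ∫⁻ y, f (y / Real.sqrt n) ∂ν :=
  lintegral_map hf (by fun_prop)

/-- At the exponent `√n u`, the step of the scaled walk has moment generating function
`E e^{u Y} / (1 + u E[Y] (1 + θ / √n))`. -/
lemma stepMGF_scaled {ν : Measure ℝ} {lam θ n u : ℝ} (hlam : 0 < lam)
    (hθ : 0 < θ) (hn : 0 < n) (hμ : 0 ≤ ∫ y, y ∂ν) (hu : 0 ≤ u)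
    (he : Integrable (fun y => Real.exp (u * y)) ν) :
    stepMGF (scaledClaimLaw ν n) (expMeasure (n * lam)) (scaledPremium lam θ ν n)
        (Real.sqrt n * u) =
      ENNReal.ofReal ((∫ y, Real.exp (u * y) ∂ν) /
        (1 + u * (∫ y, y ∂ν) * (1 + θ / Real.sqrt n))) := by
  have hσ : 0 < Real.sqrt n := Real.sqrt_pos.2 hn
  have hσn : Real.sqrt n * Real.sqrt n = n := Real.mul_self_sqrt hn.le
  set σ := Real.sqrt n with hσdef
  set μ := ∫ y, y ∂ν with hμdef
  have hc : scaledPremium lam θ ν n = lam * μ * (σ + θ) := by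
    rw [scaledPremium, premium]; ring
  have hc0 : 0 ≤ lam * μ * (σ + θ) := by positivity
  have hexp : ∫⁻ z, ENNReal.ofReal (Real.exp (σ * u * z)) ∂(scaledClaimLaw ν n) =
      ENNReal.ofReal (∫ y, Real.exp (u * y) ∂ν) := by
    rw [lintegral_scaledClaimLaw ν n (by fun_prop), ofReal_integral_eq_lintegral_ofReal he
      (Filter.Eventually.of_forall fun y => Real.exp_nonneg _)]
    refine lintegral_congr fun y => ?_
    congr 2
    rw [← hσdef]
    field_simp
  have hden : n * lam / (n * lam + σ * u * (lam * μ * (σ + θ))) =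
      (1 + u * μ * (1 + θ / σ))⁻¹ := by
    rw [← hσn]
    have h1 : 0 < 1 + u * μ * (1 + θ / σ) := by positivity
    have h2 : 0 < σ * σ * lam + σ * u * (lam * μ * (σ + θ)) := by positivity
    rw [div_eq_iff h2.ne', inv_mul_eq_div, eq_div_iff h1.ne']
    field_simp
  rw [stepMGF, hexp, hc, lintegral_exp_neg_expMeasure (by positivity) (by positivity), hden,
    ← ENNReal.ofReal_mul (integral_nonneg fun y => Real.exp_nonneg _), ← div_eq_mul_inv]

lemma scaled_overshoot_bound {ν : Measure ℝ} {n g K : ℝ} (hn : 0 < n)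
    (h : ∀ d, 0 ≤ d → ∫⁻ y in Set.Ioi d, ENNReal.ofReal (Real.exp (g / Real.sqrt n * (y - d))) ∂ν ≤
      ENNReal.ofReal K * ν (Set.Ioi d)) {y : ℝ} (hy : 0 ≤ y) :
    ∫⁻ z in Set.Ioi y, ENNReal.ofReal (Real.exp (g * (z - y))) ∂(scaledClaimLaw ν n) ≤
      ENNReal.ofReal K * scaledClaimLaw ν n (Set.Ioi y) := by
  have hσ : 0 < Real.sqrt n := Real.sqrt_pos.2 hn
  have hmeas : Measurable fun z : ℝ => z / Real.sqrt n := by fun_prop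
  have hpre : (fun z : ℝ => z / Real.sqrt n) ⁻¹' Set.Ioi y = Set.Ioi (Real.sqrt n * y) := by
    ext z
    simp only [Set.mem_preimage, Set.mem_Ioi, lt_div_iff₀ hσ, mul_comm]
  rw [scaledClaimLaw, setLIntegral_map measurableSet_Ioi (by fun_prop) hmeas,
    Measure.map_apply hmeas measurableSet_Ioi, hpre]
  convert h (Real.sqrt n * y) (by positivity) using 5 with z
  field_simp

/-- The two-sided bound on a ruin probability `p`, turned into a bound that is uniform in the
initial surplus `x`; it uses that `s x e^{-s x}` is bounded. -/
lemma abs_sub_exp_le {p g s K x : ℝ} (hx : 0 ≤ x) (hs : 0 < s) (hsg : s ≤ g) (hK : 1 ≤ K)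
    (hlow : Real.exp (-(g * x)) / K ≤ p) (hup : p ≤ Real.exp (-(s * x))) :
    |p - Real.exp (-(g * x))| ≤ (K - 1) + (g - s) / s := by
  have hr : 0 ≤ (g - s) / s := div_nonneg (sub_nonneg.2 hsg) hs.le
  rw [abs_le]
  constructor
  · have he : Real.exp (-(g * x)) ≤ 1 :=
      Real.exp_le_one_iff.2 (neg_nonpos.2 (mul_nonneg (hs.le.trans hsg) hx))
    have h1 : Real.exp (-(g * x)) - (K - 1) ≤ Real.exp (-(g * x)) / K := by
      rw [le_div_iff₀ (by linarith)]
      nlinarith [Real.exp_pos (-(g * x))]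
    linarith
  · have h1 : Real.exp (-(s * x)) * (1 - (g - s) * x) ≤ Real.exp (-(g * x)) := by
      have h2 : Real.exp (-(g * x)) = Real.exp (-(s * x)) * Real.exp (-((g - s) * x)) := by
        rw [← Real.exp_add]; congr 1; ring
      rw [h2]
      gcongr
      linarith [Real.add_one_le_exp (-((g - s) * x))]
    have h3 : s * x * Real.exp (-(s * x)) ≤ 1 :=
      (Real.mul_exp_neg_le_exp_neg_one _).trans (Real.exp_le_one_iff.2 (by norm_num))
    have h4 : Real.exp (-(s * x)) * ((g - s) * x) ≤ (g - s) / s := by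
      calc _ = (g - s) / s * (s * x * Real.exp (-(s * x))) := by field_simp
        _ ≤ _ := mul_le_of_le_one_right hr h3
    linarith

/-! ### The rate of convergence -/

theorem mainTheorem1 (ν : Measure ℝ) [IsProbabilityMeasure ν] (lam θ : ℝ)
    (hlam : 0 < lam) (hθ : 0 < θ)
    (hpos : ∀ᵐ y ∂ν, 0 < y)
    (hmgf : ∃ u₀ : ℝ, 0 < u₀ ∧
      ∀ u ∈ Set.Ioo (-u₀) u₀, Integrable (fun y => Real.exp (u * y)) ν)
    (hcond : UniformCondMoment θ ν) :
    ∃ C N₀ : ℝ, 0 < C ∧ 0 < N₀ ∧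
      ∀ n : ℝ, N₀ < n → ∀ x : ℝ, 0 ≤ x →
        ∀ (Ω : Type*) [MeasurableSpace Ω] (P : Measure Ω) [IsProbabilityMeasure P]
          (N : ℝ≥0 → Ω → ℕ) (Y : ℕ → Ω → ℝ),
          IsCramerLundberg N Y (n * lam) (scaledClaimLaw ν n) P →
          |ruinProb P N Y (scaledPremium lam θ ν n) x - Real.exp (-(ruinExponent θ ν * x))|
            ≤ C / Real.sqrt n := by
  obtain ⟨u₀, hu₀, hint⟩ := hmgf
  obtain ⟨m, D, hm, hD, hover⟩ := hcond.exists_overshoot_bound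
  have hpow : ∀ k : ℕ, Integrable (fun y : ℝ => y ^ k) ν := fun k =>
    integrable_pow_of_integrable_exp_mul (t := u₀ / 2) (by positivity)
      (hint _ ⟨by linarith, by linarith⟩) (hint _ ⟨by linarith, by linarith⟩) k
  have h1 : Integrable (fun y : ℝ => y) ν := by simpa using hpow 1
  have h2 := hpow 2
  have h3 : Integrable (fun y : ℝ => y ^ 3 * Real.exp (u₀ / 4 * y)) ν :=
    integrable_pow_mul_exp_of_integrable_exp_mul (v := u₀ / 4) (t := u₀ / 2) (by positivity)
      (hint _ ⟨by linarith, by linarith⟩) (hint _ ⟨by linarith, by linarith⟩) 3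
  have hpos' : ∀ {f : ℝ → ℝ}, Integrable f ν → (∀ y, 0 < y → 0 < f y) → 0 < ∫ y, f y ∂ν := by
    intro f hf hfpos
    have hnn : 0 ≤ᵐ[ν] f := by filter_upwards [hpos] with y hy using (hfpos y hy).le
    refine lt_of_le_of_ne (integral_nonneg_of_ae hnn) fun h0 => ?_
    have hz := (integral_eq_zero_iff_of_nonneg_ae hnn hf).1 h0.symm
    have hF : ∀ᵐ _ ∂ν, False := by
      filter_upwards [hpos, hz] with y hy hy0
      exact (hfpos y hy).ne' hy0
    exact IsProbabilityMeasure.ne_zero ν (by simpa using hF)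
  have hμ : 0 < ∫ y, y ∂ν := hpos' h1 fun y hy => hy
  have hm2 : 0 < ∫ y, y ^ 2 ∂ν := hpos' h2 fun y hy => by positivity
  have hB : 0 < ∫ y, y ^ 3 * Real.exp (u₀ / 4 * y) ∂ν := hpos' h3 fun y hy => by positivity
  set μ := ∫ y, y ∂ν with hμdef
  set m2 := ∫ y, y ^ 2 ∂ν with hm2def
  set B := ∫ y, y ^ 3 * Real.exp (u₀ / 4 * y) ∂ν with hBdef
  set g := ruinExponent θ ν with hgdef
  have hgm : g * m2 = 2 * θ * μ := by
    rw [hgdef, ruinExponent]; exact div_mul_cancel₀ _ hm2.ne'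
  have hg : 0 < g := by
    rw [hgdef, ruinExponent]; positivity
  -- `A` is chosen so that lowering the exponent from `g` to `g - A / √n` outweighs the cubic error
  -- term of the moment generating function, with a factor two to spare for strictness.
  set A := 4 * B * g ^ 2 / m2 with hA
  have hA0 : 0 < A := by positivity
  have hAm : A * m2 = 4 * B * g ^ 2 := div_mul_cancel₀ _ hm2.ne'
  -- The threshold ensures `A / √n ≤ g / 2`, `g / √n ≤ u₀ / 4` and `m ≤ n`.
  refine ⟨g * D + 2 * A / g, (2 * A / g + g / (u₀ / 4) + Real.sqrt m) ^ 2, by positivity,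
    by positivity, fun n hn x hx Ω _ P _ N Y hM => ?_⟩
  have hs0 : 0 < 2 * A / g + g / (u₀ / 4) + Real.sqrt m := by positivity
  have hn0 : 0 < n := (pow_pos hs0 2).trans hn
  have hσs := (Real.lt_sqrt hs0.le).2 hn
  have hsm : 0 < Real.sqrt m := Real.sqrt_pos.2 hm
  have hq1 : 0 < 2 * A / g := by positivity
  have hq2 : 0 < g / (u₀ / 4) := by positivity
  set σ := Real.sqrt n with hσdef
  have hσ : 0 < σ := hs0.trans hσs
  have hσm : Real.sqrt m ≤ σ := by linarith
  have hAσ : A / σ ≤ g / 2 := by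
    have : 2 * A / g < σ := by linarith
    rw [div_lt_iff₀ hg] at this
    rw [div_le_iff₀ hσ]; linarith
  have hgσ : g / σ ≤ u₀ / 4 := by
    have : g / (u₀ / 4) < σ := by linarith
    rw [div_lt_iff₀ (by positivity)] at this
    rw [div_le_iff₀ hσ]; linarith
  set s := g - A / σ with hs
  have hAσ0 : 0 < A / σ := by positivity
  have hs2 : g / 2 ≤ s := by linarith
  have hspos : 0 < s := by linarith
  have hsg : s ≤ g := by linarith
  have hsσ : s / σ ≤ g / σ := by gcongr
  have hsσ0 : 0 < s / σ := by positivity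
  have hgσ0 : 0 < g / σ := by positivity
  have hes := hint (s / σ) ⟨by linarith, by linarith⟩
  have heg := hint (g / σ) ⟨by linarith, by linarith⟩
  have hMs : stepMGF (scaledClaimLaw ν n) (expMeasure (n * lam)) (scaledPremium lam θ ν n) s
      < 1 := by
    have h := stepMGF_scaled hlam hθ hn0 hμ.le hsσ0.le hes
    rw [← hσdef, mul_div_cancel₀ s hσ.ne'] at h
    rw [h, ENNReal.ofReal_lt_one, div_lt_one (by positivity)]
    refine (integral_exp_le_cubic hpos h1 h2 hsσ0.le (hsσ.trans hgσ) hes h3).trans_lt ?_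
    rw [← hμdef, ← hm2def, ← hBdef]
    have hkey : s * m2 / 2 + B * s ^ 2 / σ < μ * θ := by
      have hs' : s * m2 = 2 * θ * μ - 4 * B * g ^ 2 / σ := by
        rw [hs, sub_mul, hgm, ← hAm]; ring
      have hsq : B * s ^ 2 / σ ≤ B * g ^ 2 / σ := by gcongr
      have hBg : 0 < B * g ^ 2 / σ := by positivity
      have : 4 * B * g ^ 2 / σ = 4 * (B * g ^ 2 / σ) := by ring
      linarith
    have hmul := mul_lt_mul_of_pos_left hkey (show 0 < s / σ / σ by positivity)
    have e1 : s / σ / σ * (s * m2 / 2 + B * s ^ 2 / σ) =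
        (s / σ) ^ 2 / 2 * m2 + (s / σ) ^ 3 * B := by
      field_simp
    have e2 : s / σ * μ * (1 + θ / σ) = s / σ * μ + s / σ / σ * (μ * θ) := by
      field_simp
    linarith
  have hMg : 1 ≤ stepMGF (scaledClaimLaw ν n) (expMeasure (n * lam)) (scaledPremium lam θ ν n)
      g := by
    have h := stepMGF_scaled hlam hθ hn0 hμ.le hgσ0.le heg
    rw [← hσdef, mul_div_cancel₀ g hσ.ne'] at h
    rw [h, ENNReal.one_le_ofReal, one_le_div (by positivity)]
    refine le_trans (le_of_eq ?_) (quadratic_le_integral_exp hpos h1 h2 hgσ0.le heg)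
    rw [← hμdef, ← hm2def]
    have e1 : (g / σ) ^ 2 / 2 * m2 = g / σ / σ * (g * m2) / 2 := by ring
    rw [e1, hgm]; ring
  have hK : ∀ y, 0 ≤ y → ∫⁻ z in Set.Ioi y, ENNReal.ofReal (Real.exp (g * (z - y)))
      ∂(scaledClaimLaw ν n) ≤
        ENNReal.ofReal (1 + g / σ * D) * scaledClaimLaw ν n (Set.Ioi y) := fun y hy =>
    scaled_overshoot_bound hn0 (hover (g / σ) hgσ0.le (by gcongr)) hy
  have hmeas : Measurable fun y : ℝ => y / Real.sqrt n := by fun_prop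
  have : IsProbabilityMeasure (scaledClaimLaw ν n) :=
    Measure.isProbabilityMeasure_map hmeas.aemeasurable
  have hη : ∀ᵐ z ∂(scaledClaimLaw ν n), 0 ≤ z := by
    rw [scaledClaimLaw, ae_map_iff hmeas.aemeasurable measurableSet_Ici]
    filter_upwards [hpos] with y hy
    exact div_nonneg hy.le hσ.le
  have hc : 0 ≤ scaledPremium lam θ ν n := by
    have : scaledPremium lam θ ν n = lam * μ * (σ + θ) := by
      rw [scaledPremium, premium]; ring
    rw [this]; positivity
  have hK1 : 1 ≤ 1 + g / σ * D := le_add_of_nonneg_right (by positivity)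
  obtain ⟨hlow, hup⟩ := ruinProb_bounds (by positivity) hc hη hM hspos.le hsg hK1 hMs hMg hK hx
  refine (abs_sub_exp_le hx hspos hsg hK1 hlow hup).trans ?_
  have hfrac : (g - s) / s ≤ A / σ / (g / 2) := by
    have : g - s = A / σ := by rw [hs]; ring
    rw [this]; gcongr
  calc _ ≤ g / σ * D + A / σ / (g / 2) := by linarith
    _ = _ := by field_simp
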